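/- Let $G=(V,E)$ be a finite simple directed planar graph with a fixed planar embedding, with arc capacities $c(e)\in[0,\infty]$, vertex capacities $c(v)\in[0,\infty]$, a source $s$ and a sink $t\neq s$ with $c(s)=c(t)=\infty$, such that $s$ has no incoming arcs, $t$ has no outgoing arcs, and $t$ lies on the boundary of the infinite face. Let the extended graph $G_e$ be obtained from $G$ by replacing every vertex $v$ of finite capacity and degree $d$ (the number of incoming and outgoing arcs) with a cycle $C_v$ on $d$ vertices $v_0,\dots,v_{d-1}$, in which $v_i$ and $v_{(i+1) \bmod d}$ are joined by an undirected edge of capacity $c(v)/2$ (that is, by two antiparallel arcs, both of capacity $c(v)/2$), and by attaching the arcs incident to $v$ to $v_0,\dots,v_{d-1}$, one arc to each vertex, in the same cyclic order. Arcs of $G$ are identified with the corresponding arcs of $G_e$ and keep their capacities; $G_e$ has no vertex capacities. For every arc $e$ of $G_e$ whose reverse $\mathrm{rev}(e)$ is not an arc, $\mathrm{rev}(e)$ is added, along the same curve, with capacity $0$. Given arc capacities, a flow function assigns to each arc a real number between $0$ and its capacity such that inflow equals outflow at every vertex other than the source and the sink; its value is the total flow that enters the sink. Let $f$ be a flow function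 in $G_e$. Define new capacities on $G_e$ by $c'(e)=f(e)$ for the arcs $e\in E$, $c'(e)=c(v)/2$ for the arcs of each $C_v$, and $c'(e)=0$ for the added reverse arcs. Let $f'$ be a flow function in $G_e$ with respect to $c'$, with the same value as $f$, such that $G_e$ has no clockwise residual cycle with respect to $f'$ and $c'$, that is, no clockwise simple cycle all of whose arcs $e$ have positive residual capacity $c'(e)-f'(e)+f'(\mathrm{rev}(e))$. Then the restriction $\hat{f'}$ of $f'$ to the arcs of $G$ has no counterclockwise flow-cycle: there is no counterclockwise simple cycle in $G$ such that $\hat{f'}(e)>0$ for each of its arcs $e$. Here a simple cycle is clockwise (counterclockwise) if the bounded region that it encloses lies on the right (left) of its arcs. -/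

import Mathlib

open scoped ENNReal

/-- A finite graph, possibly disconnected, with a combinatorial embedding in an oriented surface.
`D` is the type of darts: every edge is a pair `d`, `rev d` of oppositely directed darts that run
along the same curve, and `src d` is the vertex in which `d` starts. `rot d` is the dart that
follows `d` in counterclockwise order among the darts that start in `src d`. `F` is the type of
faces, `left d` is the face on the left of `d`, and `outer` is the infinite face. -/
structure EmbeddedGraph (V D F : Type*) where
  src : D → V
  rev : D → D
  rev_rev : ∀ d, rev (rev d) = d
  rev_ne : ∀ d, rev d ≠ d
  rot : Equiv.Perm D
  /-- The darts that start in a vertex form one cycle of `rot`. -/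
  src_eq_iff : ∀ d e, src d = src e ↔ rot.SameCycle d e
  left : D → F
  /-- The corner between `d` and the next dart `rot d` lies on the left of `d` and on the right of
  `rot d`. -/
  left_rev_rot : ∀ d, left (rev (rot d)) = left d
  outer : F

namespace EmbeddedGraph

variable {V D F : Type*} (M : EmbeddedGraph V D F)

/-- The vertex in which a dart ends. -/
def tgt (d : D) : V := M.src (M.rev d)

/-- The face on the right of a dart. -/
def right (d : D) : F := M.left (M.rev d)

/-- There is an edge from `u` to `v`. -/
def Adj (u v : V) : Prop := ∃ d, M.src d = u ∧ M.tgt d = v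

/-- Some edge that is not one of the edges of `C` separates the faces `a` and `b`. -/
def DualAdjAvoiding (C : Set D) (a b : F) : Prop :=
  ∃ d, d ∉ C ∧ M.rev d ∉ C ∧ M.left d = a ∧ M.right d = b

/-- The embedding is an embedding in the plane: the surface is connected (one can walk from any
face to any other one by crossing edges), and Euler's formula `|V| - |E| + |F| = 1 + c` holds,
where `c` is the number of connected components of the graph. The number of edges is `|D| / 2`, so
the formula is multiplied by two. -/
def IsPlanar : Prop :=
  (∀ a b : F, Relation.ReflTransGen (M.DualAdjAvoiding ∅) a b) ∧
    2 * (Nat.card V + Nat.card F) = Nat.card D + 2 * (1 + Nat.card (Quot M.Adj))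

/-- A (simple) directed cycle `C 0, C 1, …, C k`. The addition of `Fin (k + 1)` is cyclic. -/
def IsCycle {k : ℕ} (C : Fin (k + 1) → D) : Prop :=
  (∀ i, M.tgt (C i) = M.src (C (i + 1))) ∧ Function.Injective fun i => M.src (C i)

/-- The face `a` is enclosed by `C`: it cannot be reached from the infinite face without crossing
an edge of `C`. -/
def Encloses {k : ℕ} (C : Fin (k + 1) → D) (a : F) : Prop :=
  ¬ Relation.ReflTransGen (M.DualAdjAvoiding (Set.range C)) M.outer a

/-- The cycle `C` is clockwise: the region that it encloses lies on its right. -/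
def IsClockwise {k : ℕ} (C : Fin (k + 1) → D) : Prop :=
  M.IsCycle C ∧ ∀ i, M.Encloses C (M.right (C i))

/-- The cycle `C` is counterclockwise: the region that it encloses lies on its left. -/
def IsCounterclockwise {k : ℕ} (C : Fin (k + 1) → D) : Prop :=
  M.IsCycle C ∧ ∀ i, M.Encloses C (M.left (C i))

open Classical in
/-- The amount of `f` that enters `v`. -/
noncomputable def inflow [Fintype D] (f : D → ℝ) (v : V) : ℝ := ∑ d with M.tgt d = v, f d

open Classical in
/-- The amount of `f` that leaves `v`. -/
noncomputable def outflow [Fintype D] (f : D → ℝ) (v : V) : ℝ := ∑ d with M.src d = v, f d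

/-- `f` is a flow function from `s` to `t` with respect to the arc capacities `c` (there are no
vertex capacities). A dart that is not an arc of the graph has capacity `0`. -/
def IsFlow [Fintype D] (c : D → ℝ≥0∞) (s t : V) (f : D → ℝ) : Prop :=
  (∀ d, 0 ≤ f d ∧ ENNReal.ofReal (f d) ≤ c d) ∧
    ∀ v, v ≠ s → v ≠ t → M.inflow f v = M.outflow f v

/-- The residual capacity `c(e) - f(e) + f(rev(e))`. -/
noncomputable def resCap (c : D → ℝ≥0∞) (f : D → ℝ) (d : D) : EReal :=
  (c d : EReal) - (f d : EReal) + (f (M.rev d) : EReal)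

end EmbeddedGraph

/-- A simple directed plane graph with arc capacities, vertex capacities, a source and a sink.

Every arc is a dart, and every edge of the embedding carries an arc. Usually each arc has an edge of
its own, so that `rev` of it is an added arc of capacity `0`. Two antiparallel arcs may be drawn as
two edges; if both of their ends have infinite capacity, they may also share one edge. -/
structure PlanarNetwork (V D F : Type*) extends EmbeddedGraph V D F where
  isPlanar : toEmbeddedGraph.IsPlanar
  arcs : Set D
  arc_or_rev : ∀ d, d ∈ arcs ∨ rev d ∈ arcs
  no_loop : ∀ d, toEmbeddedGraph.tgt d ≠ src d
  no_parallel : ∀ d ∈ arcs, ∀ e ∈ arcs, src d = src e →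
    toEmbeddedGraph.tgt d = toEmbeddedGraph.tgt e → d = e
  /-- The capacities of the arcs. -/
  cap : D → ℝ≥0∞
  cap_of_notMem : ∀ d, d ∉ arcs → cap d = 0
  /-- The capacities of the vertices. -/
  vcap : V → ℝ≥0∞
  rev_notMem_of_vcap : ∀ d ∈ arcs, vcap (src d) ≠ ⊤ → rev d ∉ arcs
  rev_notMem_of_vcap' : ∀ d ∈ arcs, vcap (toEmbeddedGraph.tgt d) ≠ ⊤ → rev d ∉ arcs
  /-- The source. -/
  s : V
  /-- The sink. -/
  t : V
  s_ne_t : s ≠ t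
  vcap_s : vcap s = ⊤
  vcap_t : vcap t = ⊤
  /-- The source has no incoming arcs. -/
  tgt_ne_s : ∀ d ∈ arcs, toEmbeddedGraph.tgt d ≠ s
  /-- The sink has no outgoing arcs. -/
  src_ne_t : ∀ d ∈ arcs, src d ≠ t
  /-- The sink is on the boundary of the infinite face (unless it is an isolated vertex). -/
  t_outer : (∃ d, src d = t) → ∃ d, src d = t ∧ left d = outer

namespace PlanarNetwork

variable {V D F : Type*} (N : PlanarNetwork V D F)

/-- The darts that start in a vertex of finite capacity. -/
abbrev FinDart : Type _ := {d : D // N.vcap (N.src d) ≠ ⊤}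

/-- The vertices of the extended graph: the vertices of infinite capacity, and for every vertex `v`
of finite capacity one vertex for each dart `d` that starts in `v`. -/
abbrev ExtVertex : Type _ := {v : V // N.vcap v = ⊤} ⊕ N.FinDart

/-- The darts of the extended graph: those of the graph, and for each dart `a` that starts in a
vertex `v` of finite capacity the two darts of an edge of the cycle `C_v`; `(a, true)` goes
(counterclockwise along `C_v`) from the vertex of `a` to the vertex of `rot a`, and `(a, false)`
goes back. -/
abbrev ExtDart : Type _ := D ⊕ (N.FinDart × Bool)

/-- The faces of the extended graph: those of the graph, and the disc inside each cycle `C_v`. -/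
abbrev ExtFace : Type _ := F ⊕ {v : V // N.vcap v ≠ ⊤ ∧ ∃ d, N.src d = v}

theorem src_rot (d : D) : N.src (N.rot d) = N.src d :=
  (N.src_eq_iff _ _).2 (Equiv.Perm.SameCycle.refl _ _).apply_left

theorem src_rot_symm (d : D) : N.src (N.rot.symm d) = N.src d := by
  rw [← N.src_rot, Equiv.apply_symm_apply]

/-- The next dart around the same vertex of finite capacity. -/
def finRot (a : N.FinDart) : N.FinDart := ⟨N.rot a.1, by rw [N.src_rot]; exact a.2⟩

/-- The previous dart around the same vertex of finite capacity. -/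
def finRotSymm (a : N.FinDart) : N.FinDart := ⟨N.rot.symm a.1, by rw [N.src_rot_symm]; exact a.2⟩

@[simp] theorem finRot_finRotSymm (a : N.FinDart) : N.finRot (N.finRotSymm a) = a :=
  Subtype.ext (by simp [finRot, finRotSymm])

@[simp] theorem finRotSymm_finRot (a : N.FinDart) : N.finRotSymm (N.finRot a) = a :=
  Subtype.ext (by simp [finRot, finRotSymm])

open Classical in
noncomputable def extSrc : N.ExtDart → N.ExtVertex
  | Sum.inl d => if h : N.vcap (N.src d) = ⊤ then Sum.inl ⟨N.src d, h⟩ else Sum.inr ⟨d, h⟩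
  | Sum.inr (a, true) => Sum.inr a
  | Sum.inr (a, false) => Sum.inr (N.finRot a)

def extRev : N.ExtDart → N.ExtDart
  | Sum.inl d => Sum.inl (N.rev d)
  | Sum.inr (a, b) => Sum.inr (a, !b)

open Classical in
/-- Around a vertex of `C_v` that belongs to the dart `a`, the counterclockwise order is: `a`, the
edge of `C_v` to the vertex of `rot a`, the edge of `C_v` to the vertex of `rot⁻¹ a`. -/
noncomputable def extRot : Equiv.Perm N.ExtDart where
  toFun
    | Sum.inl d => if h : N.vcap (N.src d) = ⊤ then Sum.inl (N.rot d) else Sum.inr (⟨d, h⟩, true)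
    | Sum.inr (a, true) => Sum.inr (N.finRotSymm a, false)
    | Sum.inr (a, false) => Sum.inl (N.finRot a).1
  invFun
    | Sum.inl d => if h : N.vcap (N.src d) = ⊤ then Sum.inl (N.rot.symm d)
        else Sum.inr (N.finRotSymm ⟨d, h⟩, false)
    | Sum.inr (a, true) => Sum.inl a.1
    | Sum.inr (a, false) => Sum.inr (N.finRot a, true)
  left_inv x := by
    rcases x with d | ⟨a, _ | _⟩
    · by_cases h : N.vcap (N.src d) = ⊤ <;> simp [h, N.src_rot]
    · simp [(N.finRot a).2]
    · simp
  right_inv x := by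
    rcases x with d | ⟨a, _ | _⟩
    · by_cases h : N.vcap (N.src d) = ⊤ <;> simp [h, N.src_rot_symm]
    · simp
    · simp [a.2]

def extLeft : N.ExtDart → N.ExtFace
  | Sum.inl d => Sum.inl (N.left d)
  | Sum.inr (a, true) => Sum.inr ⟨N.src a.1, a.2, a.1, rfl⟩
  | Sum.inr (a, false) => Sum.inl (N.left a.1)

theorem extRot_inl_of_eq {d : D} (h : N.vcap (N.src d) = ⊤) :
    N.extRot (Sum.inl d) = Sum.inl (N.rot d) := by simp [extRot, h]

theorem extRot_inl_of_ne {d : D} (h : N.vcap (N.src d) ≠ ⊤) :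
    N.extRot (Sum.inl d) = Sum.inr (⟨d, h⟩, true) := by simp [extRot, h]

theorem extRot_true (a : N.FinDart) :
    N.extRot (Sum.inr (a, true)) = Sum.inr (N.finRotSymm a, false) := rfl

theorem extRot_false (a : N.FinDart) :
    N.extRot (Sum.inr (a, false)) = Sum.inl (N.finRot a).1 := rfl

theorem extSrc_extRot (x : N.ExtDart) : N.extSrc (N.extRot x) = N.extSrc x := by
  rcases x with d | ⟨a, _ | _⟩
  · by_cases h : N.vcap (N.src d) = ⊤
    · simp [N.extRot_inl_of_eq h, extSrc, N.src_rot, h]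
    · simp [N.extRot_inl_of_ne h, extSrc, h]
  · simp [extRot_false, extSrc, (N.finRot a).2]
  · simp [extRot_true, extSrc]

theorem extSrc_of_sameCycle {x y : N.ExtDart} (h : N.extRot.SameCycle x y) :
    N.extSrc x = N.extSrc y := by
  obtain ⟨n, rfl⟩ := h
  induction n with
  | zero => simp
  | succ n ih => rw [add_comm, zpow_add, zpow_one, Equiv.Perm.mul_apply, extSrc_extRot, ih]
  | pred n ih =>
    rw [ih, ← N.extSrc_extRot ((N.extRot ^ (-(n : ℤ) - 1)) x), ← Equiv.Perm.mul_apply,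
      ← zpow_one_add]
    congr 3
    ring

/-- Every dart of the extended graph has, around its source, a dart of the graph. -/
theorem exists_inl_sameCycle (x : N.ExtDart) : ∃ d, N.extRot.SameCycle x (Sum.inl d) := by
  rcases x with d | ⟨a, _ | _⟩
  · exact ⟨d, Equiv.Perm.SameCycle.refl _ _⟩
  · exact ⟨(N.finRot a).1, 1, by rw [zpow_one, extRot_false]⟩
  · refine ⟨a.1, 2, ?_⟩
    rw [zpow_two, Equiv.Perm.mul_apply, extRot_true, extRot_false, finRot_finRotSymm]

theorem extRot_sameCycle_inl {d e : D} (h : N.vcap (N.src d) = ⊤) (hde : N.rot.SameCycle d e) :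
    N.extRot.SameCycle (Sum.inl d) (Sum.inl e) := by
  have key : ∀ x : D, N.vcap (N.src x) = ⊤ →
      N.extRot.SameCycle (Sum.inl x) (Sum.inl (N.rot x)) := fun x hx =>
    ⟨1, by rw [zpow_one, N.extRot_inl_of_eq hx]⟩
  obtain ⟨n, rfl⟩ := hde
  have hs : ∀ m : ℤ, N.src ((N.rot ^ m) d) = N.src d := fun m =>
    ((N.src_eq_iff _ _).2 ⟨m, rfl⟩).symm
  induction n with
  | zero => simpa using Equiv.Perm.SameCycle.refl _ _
  | succ n ih =>
    refine ih.trans ?_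
    rw [add_comm, zpow_add, zpow_one, Equiv.Perm.mul_apply]
    exact key _ (by rw [hs]; exact h)
  | pred n ih =>
    refine ih.trans ?_
    have := key ((N.rot ^ (-(n : ℤ) - 1)) d) (by rw [hs]; exact h)
    rw [← Equiv.Perm.mul_apply, ← zpow_one_add] at this
    rw [show (1 : ℤ) + (-(n : ℤ) - 1) = -n by ring] at this
    exact this.symm

theorem extSrc_eq_iff (x y : N.ExtDart) :
    N.extSrc x = N.extSrc y ↔ N.extRot.SameCycle x y := by
  refine ⟨fun hxy => ?_, N.extSrc_of_sameCycle⟩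
  obtain ⟨d, hd⟩ := N.exists_inl_sameCycle x
  obtain ⟨e, he⟩ := N.exists_inl_sameCycle y
  rw [N.extSrc_of_sameCycle hd, N.extSrc_of_sameCycle he] at hxy
  refine hd.trans (Equiv.Perm.SameCycle.trans ?_ he.symm)
  by_cases h : N.vcap (N.src d) = ⊤ <;> by_cases h' : N.vcap (N.src e) = ⊤
  · simp only [extSrc, h, h', dif_pos, Sum.inl.injEq, Subtype.mk.injEq] at hxy
    exact N.extRot_sameCycle_inl h ((N.src_eq_iff _ _).1 hxy)
  · simp [extSrc, h, h'] at hxy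
  · simp [extSrc, h, h'] at hxy
  · simp only [extSrc, h, h', dif_neg, not_false_eq_true, Sum.inr.injEq, Subtype.mk.injEq] at hxy
    rw [hxy]

/-- The extended graph: every vertex `v` of finite capacity and degree `n` is replaced by a cycle
`C_v` of length `n`, and the darts that start in `v` are attached to the vertices of `C_v`, one to
each, in the same cyclic order. -/
noncomputable def extGraph : EmbeddedGraph N.ExtVertex N.ExtDart N.ExtFace where
  src := N.extSrc
  rev := N.extRev
  rev_rev x := by rcases x with d | ⟨a, b⟩ <;> simp [extRev, N.rev_rev]
  rev_ne x := by rcases x with d | ⟨a, b⟩ <;> simp [extRev, N.rev_ne]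
  rot := N.extRot
  src_eq_iff := N.extSrc_eq_iff
  left := N.extLeft
  left_rev_rot x := by
    rcases x with d | ⟨a, _ | _⟩
    · by_cases h : N.vcap (N.src d) = ⊤
      · rw [N.extRot_inl_of_eq h]; simp [extRev, extLeft, N.left_rev_rot]
      · rw [N.extRot_inl_of_ne h]; simp [extRev, extLeft]
    · rw [N.extRot_false]; simp [extRev, extLeft, finRot, N.left_rev_rot]
    · rw [N.extRot_true]; simp [extRev, extLeft, finRotSymm, N.src_rot_symm]
  outer := Sum.inl N.outer

/-- The source of the extended graph. -/
def extS : N.ExtVertex := Sum.inl ⟨N.s, N.vcap_s⟩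

/-- The sink of the extended graph. -/
def extT : N.ExtVertex := Sum.inl ⟨N.t, N.vcap_t⟩

/-- The capacities of the extended graph: both darts of an edge of `C_v` have capacity
`c(v) / 2`. -/
noncomputable def extCap : N.ExtDart → ℝ≥0∞
  | Sum.inl d => N.cap d
  | Sum.inr (a, _) => N.vcap (N.src a.1) / 2

open Classical in
/-- The capacities `c'` that belong to a flow `f` in the extended graph: `c'(e) = f(e)` for the arcs
`e` of the original graph, `c'(e) = c(v) / 2` for the darts of `C_v`, and `c'(e) = 0` for the added
reverse darts. -/
noncomputable def cappedCap (f : N.ExtDart → ℝ) : N.ExtDart → ℝ≥0∞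
  | Sum.inl d => if d ∈ N.arcs then ENNReal.ofReal (f (Sum.inl d)) else 0
  | Sum.inr (a, _) => N.vcap (N.src a.1) / 2

/-- The restriction of a function on the darts of the extended graph to the original graph. -/
def restrict (f : N.ExtDart → ℝ) : D → ℝ := fun d => f (Sum.inl d)

/-- `C` is a flow-cycle of `g` in the original graph: a cycle of arcs on which `g` is positive. -/
def IsFlowCycle {k : ℕ} (g : D → ℝ) (C : Fin (k + 1) → D) : Prop :=
  N.IsCycle C ∧ ∀ i, C i ∈ N.arcs ∧ 0 < g (C i)

end PlanarNetwork

/-! Suppose that the restriction of `f'` has a counterclockwise flow-cycle, and let `Q` be its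
strongly connected component in the graph of flow-carrying darts. A circulation positive exactly on
the darts within `Q` is the difference of a face potential, which drops from left to right across
every one-way dart of `Q`. The enclosed faces of maximal potential form a region `Ψ` that avoids the
infinite face and has the bounding darts of `Q` on its left (`HasPotentials.exists_isCcwRegion`).

On the other hand, without clockwise residual cycles every face of the extended graph can be reached
from the infinite one by crossing only non-residual darts, from left to right
(`reachable_of_no_isClockwise`): the boundary of the reachable set would otherwise contain a
clockwise residual cycle. It remains to see that such crossings never enter `Ψ`. For an arc of `G`
this is the orientation of the boundary of `Ψ`. To enter through `C_v` one must cross a dart of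
`C_v` saturated counterclockwise. Flow from `Q` entering further along would overload `C_v`, and
flow leaving `v` inside `Ψ` stays in `Q` (`mem_of_isCcwRegion`), which the boundary orientation
forbids. So the saturation persists all around `v`, and all faces at `v` lie in `Ψ`
(`left_mem_of_saturated`).

Planarity enters through dual connectivity and the existence of potentials for circulations, which
follows from Euler's formula. -/

namespace EmbeddedGraph

variable {V D F : Type*} (M : EmbeddedGraph V D F)

/-! ### Face potentials of circulations, from Euler's formula -/

theorem right_rot (d : D) : M.right (M.rot d) = M.left d := M.left_rev_rot d

theorem left_rev (d : D) : M.left (M.rev d) = M.right d := rfl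

theorem right_rev (d : D) : M.right (M.rev d) = M.left d := by rw [right, M.rev_rev]

theorem src_rev (d : D) : M.src (M.rev d) = M.tgt d := rfl

theorem tgt_rev (d : D) : M.tgt (M.rev d) = M.src d := by rw [tgt, M.rev_rev]

theorem src_rot' (d : D) : M.src (M.rot d) = M.src d :=
  ((M.src_eq_iff _ _).2 ⟨1, by simp⟩).symm

/-- A property of darts that is preserved by `rot` holds for all darts around a vertex if it holds
for one. -/
theorem forall_of_src_eq [Finite D] {p : D → Prop} {v : V}
    (hp : ∀ d, M.src d = v → p d → p (M.rot d))
    {d e : D} (hd : M.src d = v) (hde : M.src e = v) (h : p d) : p e := by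
  obtain ⟨n, -, rfl⟩ := ((M.src_eq_iff d e).1 (hd.trans hde.symm)).exists_pow_eq'
  have : ∀ n : ℕ, M.src ((M.rot ^ n) d) = v ∧ p ((M.rot ^ n) d) := by
    intro n
    induction n with
    | zero => exact ⟨hd, h⟩
    | succ n ih =>
      rw [pow_succ', Equiv.Perm.mul_apply, M.src_rot']
      exact ⟨ih.1, hp _ ih.1 ih.2⟩
  exact (this n).2

open Classical in
/-- The potential difference along the darts around a vertex sums up to zero. -/
theorem sum_left_sub_right [Fintype D] (φ : F → ℝ) (v : V) :
    ∑ d with M.src d = v, (φ (M.left d) - φ (M.right d)) = 0 := by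
  rw [Finset.sum_sub_distrib, sub_eq_zero, Finset.sum_filter, Finset.sum_filter,
    ← Equiv.sum_comp M.rot (fun d => if M.src d = v then φ (M.right d) else 0)]
  simp [right_rot, src_rot']

open Classical in
/-- Every circulation comes from a potential on the faces: the first homology vanishes. -/
def HasPotentials [Fintype D] : Prop :=
  ∀ x : D → ℝ, (∀ d, x (M.rev d) = -x d) → (∀ v, ∑ d with M.src d = v, x d = 0) →
    ∃ φ : F → ℝ, ∀ d, x d = φ (M.left d) - φ (M.right d)

/-- The antisymmetric functions on the darts. -/
def antisymm : Submodule ℝ (D → ℝ) where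
  carrier := {x | ∀ d, x (M.rev d) = -x d}
  add_mem' := by intro a b ha hb d; simp [ha d, hb d]; ring
  zero_mem' := by intro d; simp
  smul_mem' := by intro c x hx d; simp [hx d]

/-- One dart per edge determines an antisymmetric function; the arbitrary enumeration `r` selects
that dart. -/
theorem two_mul_finrank_antisymm_le [Fintype D] :
    2 * Module.finrank ℝ M.antisymm ≤ Fintype.card D := by
  classical
  let r := Fintype.equivFin D
  let O := {d : D // r d < r (M.rev d)}
  let res : M.antisymm →ₗ[ℝ] (O → ℝ) :=
    (LinearMap.funLeft ℝ ℝ (Subtype.val : O → D)).comp M.antisymm.subtype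
  have hinj : Function.Injective res := by
    rw [← LinearMap.ker_eq_bot, LinearMap.ker_eq_bot']
    rintro ⟨x, hx⟩ h
    ext d
    rcases lt_trichotomy (r d) (r (M.rev d)) with h1 | h1 | h1
    · exact congrFun h ⟨d, h1⟩
    · exact absurd (r.injective h1).symm (M.rev_ne d)
    · have := congrFun h ⟨M.rev d, by rwa [M.rev_rev]⟩
      have h2 : x (M.rev d) = 0 := this
      have h3 := hx d
      change x d = 0
      linarith
  have h1 := LinearMap.finrank_le_finrank_of_injective hinj
  rw [Module.finrank_fintype_fun_eq_card] at h1
  have h2 : Fintype.card (O ⊕ O) ≤ Fintype.card D := by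
    refine Fintype.card_le_of_injective
      (Sum.elim (fun d : O => d.1) (fun d : O => M.rev d.1)) ?_
    have hr : Function.Injective M.rev := Function.Involutive.injective M.rev_rev
    rintro (⟨a, ha⟩ | ⟨a, ha⟩) (⟨b, hb⟩ | ⟨b, hb⟩) h <;> simp only [Sum.elim_inl, Sum.elim_inr] at h
    · subst h; rfl
    · subst h; rw [M.rev_rev] at ha; exact absurd ha hb.not_gt
    · subst h; rw [M.rev_rev] at hb; exact absurd ha hb.not_gt
    · obtain rfl := hr h; rfl
  rw [Fintype.card_sum] at h2
  omega

/-- The coboundary of a function on the vertices. -/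
def vertexCoboundary : (V → ℝ) →ₗ[ℝ] (D → ℝ) :=
  LinearMap.funLeft ℝ ℝ M.src - LinearMap.funLeft ℝ ℝ M.tgt

/-- The coboundary of a function on the faces. -/
def faceCoboundary : (F → ℝ) →ₗ[ℝ] (D → ℝ) :=
  LinearMap.funLeft ℝ ℝ M.left - LinearMap.funLeft ℝ ℝ M.right

theorem vertexCoboundary_apply (p : V → ℝ) (d : D) :
    M.vertexCoboundary p d = p (M.src d) - p (M.tgt d) := rfl

theorem faceCoboundary_apply (p : F → ℝ) (d : D) :
    M.faceCoboundary p d = p (M.left d) - p (M.right d) := rfl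

theorem finrank_ker_vertexCoboundary_le [Fintype V] :
    Module.finrank ℝ (LinearMap.ker M.vertexCoboundary) ≤ Nat.card (Quot M.Adj) := by
  classical
  have : Fintype (Quot M.Adj) := Fintype.ofFinite _
  rw [Nat.card_eq_fintype_card, ← Module.finrank_fintype_fun_eq_card ℝ]
  have h : LinearMap.ker M.vertexCoboundary ≤
      LinearMap.range (LinearMap.funLeft ℝ ℝ (Quot.mk M.Adj)) := by
    intro p hp
    have hp' : ∀ u v, M.Adj u v → p u = p v := by
      rintro u v ⟨d, rfl, rfl⟩
      have := congrFun (LinearMap.mem_ker.1 hp) d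
      rw [vertexCoboundary_apply] at this
      exact sub_eq_zero.1 this
    exact ⟨Quot.lift p hp', rfl⟩
  exact (Submodule.finrank_mono h).trans (LinearMap.finrank_range_le _)

theorem finrank_ker_faceCoboundary_le [Fintype F]
    (h : ∀ a b : F, Relation.ReflTransGen (M.DualAdjAvoiding ∅) a b) :
    Module.finrank ℝ (LinearMap.ker M.faceCoboundary) ≤ 1 := by
  refine finrank_le_one (⟨fun _ => 1, by ext d; simp [faceCoboundary_apply]⟩) ?_
  rintro ⟨p, hp⟩
  refine ⟨p M.outer, ?_⟩
  ext a
  have : p M.outer = p a := by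
    induction h M.outer a with
    | refl => rfl
    | tail _ hs ih =>
      obtain ⟨d, -, -, rfl, rfl⟩ := hs
      have := congrFun (LinearMap.mem_ker.1 hp) d
      rw [faceCoboundary_apply] at this
      exact ih.trans (sub_eq_zero.1 this)
  simpa using this

-- Summation by parts: reversing darts turns the head terms into tail terms, and grouping by source
-- leaves the divergence of `x`, which vanishes.
open Classical in
theorem sum_mul_vertexCoboundary [Fintype V] [Fintype D] {x : D → ℝ}
    (hx : ∀ d, x (M.rev d) = -x d) (hv : ∀ v, ∑ d with M.src d = v, x d = 0) (p : V → ℝ) :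
    ∑ d, x d * M.vertexCoboundary p d = 0 := by
  have h1 : ∑ d, x d * p (M.src d) = 0 := by
    rw [← Finset.sum_fiberwise Finset.univ M.src]
    refine Finset.sum_eq_zero fun v _ => ?_
    have : ∑ d with M.src d = v, x d * p (M.src d) = (∑ d with M.src d = v, x d) * p v := by
      rw [Finset.sum_mul]
      exact Finset.sum_congr rfl fun d hd => by rw [(Finset.mem_filter.1 hd).2]
    rw [this, hv, zero_mul]
  have h2 : ∑ d, x d * p (M.tgt d) = -∑ d, x d * p (M.src d) := by
    rw [← Equiv.sum_comp (Function.Involutive.toPerm M.rev M.rev_rev), ← Finset.sum_neg_distrib]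
    refine Finset.sum_congr rfl fun d _ => ?_
    change x (M.rev d) * p (M.tgt (M.rev d)) = _
    rw [hx, tgt_rev, neg_mul]
  simp only [vertexCoboundary_apply, mul_sub, Finset.sum_sub_distrib, h1, h2]
  simp

/-- Vertex and face coboundaries are orthogonal, and by Euler's formula their dimensions add up to
that of all antisymmetric functions. A circulation is orthogonal to the former, hence is one of the
latter. -/
theorem IsPlanar.hasPotentials [Fintype V] [Fintype D] [Fintype F] (h : M.IsPlanar) :
    M.HasPotentials := by
  classical
  intro x hx hv
  obtain ⟨hconn, heuler⟩ := h
  set T := LinearMap.range M.vertexCoboundary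
  set B := LinearMap.range M.faceCoboundary
  have hT : T ≤ M.antisymm := by
    rintro _ ⟨p, rfl⟩ d
    simp [vertexCoboundary_apply, tgt_rev, src_rev]
  have hB : B ≤ M.antisymm := by
    rintro _ ⟨p, rfl⟩ d
    simp [faceCoboundary_apply, left_rev, right_rev]
  have horth : ∀ y z : D → ℝ, (∃ p, M.faceCoboundary p = y) → z ∈ T → ∑ d, y d * z d = 0 := by
    rintro _ _ ⟨p, rfl⟩ ⟨q, rfl⟩
    exact M.sum_mul_vertexCoboundary (hB ⟨p, rfl⟩) (M.sum_left_sub_right p) q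
  have hdisj : T ⊓ B = ⊥ := by
    rw [eq_bot_iff]
    rintro y ⟨h1, h2⟩
    have := horth y y h2 h1
    rw [Finset.sum_eq_zero_iff_of_nonneg fun d _ => mul_self_nonneg _] at this
    ext d
    simpa using this d
  have hsup : T ⊔ B = M.antisymm := by
    -- Rank-nullity gives `dim T ≥ |V| - c` and `dim B ≥ |F| - 1`; Euler's formula makes the sum of
    -- these bounds `|D| / 2`.
    refine Submodule.eq_of_le_of_finrank_le (sup_le hT hB) ?_
    have h1 := Submodule.finrank_sup_add_finrank_inf_eq T B
    rw [hdisj, finrank_bot] at h1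
    have h2 : Module.finrank ℝ T + _ = _ :=
      LinearMap.finrank_range_add_finrank_ker M.vertexCoboundary
    have h3 : Module.finrank ℝ B + _ = _ :=
      LinearMap.finrank_range_add_finrank_ker M.faceCoboundary
    have h4 := M.finrank_ker_vertexCoboundary_le
    have h5 := M.finrank_ker_faceCoboundary_le hconn
    have h6 := M.two_mul_finrank_antisymm_le
    rw [Module.finrank_fintype_fun_eq_card] at h2 h3
    simp only [Nat.card_eq_fintype_card (α := V), Nat.card_eq_fintype_card (α := F),
      Nat.card_eq_fintype_card (α := D)] at heuler
    omega
  have hxA : x ∈ T ⊔ B := by rw [hsup]; exact hx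
  obtain ⟨y, hy, _, ⟨φ, rfl⟩, hyz⟩ := Submodule.mem_sup.1 hxA
  -- The vertex part `y` of `x` is orthogonal to `x` and to the face part, hence to itself.
  have h0 : ∑ d, y d * y d = 0 := by
    have h1 := horth _ y ⟨φ, rfl⟩ hy
    obtain ⟨p, rfl⟩ := hy
    have h2 := M.sum_mul_vertexCoboundary hx hv p
    rw [← hyz] at h2
    simp only [Pi.add_apply, add_mul, Finset.sum_add_distrib] at h2
    linarith
  rw [Finset.sum_eq_zero_iff_of_nonneg fun d _ => mul_self_nonneg _] at h0
  refine ⟨φ, fun d => ?_⟩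
  have h1 : y d = 0 := by simpa using h0 d
  rw [← hyz, Pi.add_apply, h1, zero_add, faceCoboundary_apply]

end EmbeddedGraph

/-! ### Directed cycles and one-sided reachability of faces -/

namespace EmbeddedGraph

variable {V D F : Type*} (M : EmbeddedGraph V D F)

/-- A finite nonempty set of darts that can be left from wherever it leads contains a cycle. -/
theorem exists_isCycle [Finite D] {B : Set D} (hne : B.Nonempty)
    (hB : ∀ d ∈ B, ∃ e ∈ B, M.src e = M.tgt d) :
    ∃ (k : ℕ) (C : Fin (k + 1) → D), M.IsCycle C ∧ ∀ i, C i ∈ B := by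
  classical
  let W := {v : V // ∃ d ∈ B, M.src d = v}
  choose g hgB hgs using fun w : W => w.2
  -- With one outgoing dart chosen per vertex, walking is a self-map of a finite set; a minimal
  -- period of it yields a simple cycle.
  let step : W → W := fun w =>
    ⟨M.tgt (g w), (hB _ (hgB w)).imp fun _ h => h⟩
  have : Finite W := by
    refine Finite.of_surjective (fun d : B => (⟨M.src d.1, d.1, d.2, rfl⟩ : W)) ?_
    rintro ⟨_, d, hd, rfl⟩
    exact ⟨⟨d, hd⟩, rfl⟩
  obtain ⟨d0, hd0⟩ := hne
  let w0 : W := ⟨M.src d0, d0, hd0, rfl⟩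
  obtain ⟨m, n, hmn, hw⟩ := Finite.exists_ne_map_eq_of_infinite fun n : ℕ => step^[n] w0
  obtain ⟨w, hwp⟩ : ∃ w, w ∈ Function.periodicPts step := by
    rcases lt_or_gt_of_ne hmn with h | h
    · refine ⟨step^[m] w0, n - m, by omega, ?_⟩
      rw [Function.IsPeriodicPt, Function.IsFixedPt, ← Function.iterate_add_apply,
        Nat.sub_add_cancel h.le]
      exact hw.symm
    · refine ⟨step^[n] w0, m - n, by omega, ?_⟩
      rw [Function.IsPeriodicPt, Function.IsFixedPt, ← Function.iterate_add_apply,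
        Nat.sub_add_cancel h.le]
      exact hw
  have hpos := Function.minimalPeriod_pos_of_mem_periodicPts hwp
  obtain ⟨k, hk⟩ : ∃ k, Function.minimalPeriod step w = k + 1 :=
    ⟨_, (Nat.succ_pred_eq_of_pos hpos).symm⟩
  refine ⟨k, fun i => g (step^[i] w), ⟨fun i => ?_, ?_⟩, fun i => hgB _⟩
  · rw [hgs]
    have h1 : M.tgt (g (step^[i] w)) = (step^[(i : ℕ) + 1] w).1 := by
      rw [Function.iterate_succ_apply']
    rw [h1]
    congr 1
    -- The index wraps modulo `k + 1`, which is the minimal period.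
    rw [Fin.val_add, ← Function.iterate_mod_minimalPeriod_eq (n := (i : ℕ) + 1), hk]
    simp
  · intro i j hij
    have h1 : step^[i] w = step^[j] w := by
      apply Subtype.ext
      rw [← hgs (step^[i] w), ← hgs (step^[j] w)]
      exact hij
    have h2 := (Function.iterate_eq_iterate_iff_of_lt_minimalPeriod
      (by rw [hk]; exact i.2) (by rw [hk]; exact j.2)).1 h1
    exact Fin.ext h2

theorem rev_eq_iff {d e : D} : M.rev d = e ↔ d = M.rev e :=
  ⟨fun h => by rw [← h, M.rev_rev], fun h => by rw [h, M.rev_rev]⟩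

open Classical in
theorem sum_unit [Fintype D] (d : D) (v : V) :
    ∑ e with M.src e = v, ((if e = d then (1 : ℝ) else 0) - (if M.rev e = d then 1 else 0)) =
      (if M.src d = v then 1 else 0) - (if M.tgt d = v then 1 else 0) := by
  rw [Finset.sum_sub_distrib]
  simp [rev_eq_iff, Finset.sum_ite_eq', src_rev]

open Classical in
/-- The circulation that runs once along a closed walk. -/
noncomputable def cycleCirculation {k : ℕ} (C : Fin (k + 1) → D) (d : D) : ℝ :=
  ∑ i, ((if d = C i then 1 else 0) - (if M.rev d = C i then 1 else 0))

open Classical in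
theorem sum_cycleCirculation [Fintype D] {k : ℕ} {C : Fin (k + 1) → D} (hC : M.IsCycle C) (v : V) :
    ∑ d with M.src d = v, M.cycleCirculation C d = 0 := by
  simp only [cycleCirculation]
  rw [Finset.sum_comm]
  rw [Finset.sum_congr rfl fun i _ => M.sum_unit (C i) v, Finset.sum_sub_distrib, sub_eq_zero]
  simp only [hC.1]
  exact (Equiv.sum_comp (Equiv.addRight (1 : Fin (k + 1)))
    (fun i => if M.src (C i) = v then (1 : ℝ) else 0)).symm

open Classical in
theorem cycleCirculation_rev {k : ℕ} (C : Fin (k + 1) → D) (d : D) :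
    M.cycleCirculation C (M.rev d) = -M.cycleCirculation C d := by
  rw [cycleCirculation, cycleCirculation, ← Finset.sum_neg_distrib]
  refine Finset.sum_congr rfl fun i _ => ?_
  rw [neg_sub]
  congr 1
  exact if_congr (by rw [M.rev_rev]) rfl rfl

open Classical in
theorem cycleCirculation_eq_zero {k : ℕ} {C : Fin (k + 1) → D} {d : D}
    (h1 : d ∉ Set.range C) (h2 : M.rev d ∉ Set.range C) : M.cycleCirculation C d = 0 := by
  refine Finset.sum_eq_zero fun i _ => ?_
  rw [if_neg fun h => h1 ⟨i, h.symm⟩, if_neg fun h => h2 ⟨i, h.symm⟩, sub_zero]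

theorem cycleCirculation_pos {k : ℕ} {C : Fin (k + 1) → D} (i : Fin (k + 1))
    (h : M.rev (C i) ∉ Set.range C) : 0 < M.cycleCirculation C (C i) := by
  classical
  have h1 : ∀ j, ¬ M.rev (C i) = C j := fun j hj => h ⟨j, hj.symm⟩
  simp only [cycleCirculation, h1, if_false, sub_zero]
  refine Finset.sum_pos' (fun j _ => by split_ifs <;> simp) ⟨i, Finset.mem_univ _, by simp⟩

/-- If a set of darts contains no clockwise cycle, then every face can be reached from the infinite
face by crossing, from left to right, only darts outside of that set. -/
theorem reachable_of_no_isClockwise [Fintype D] (hM : M.HasPotentials)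
    (hconn : ∀ a, Relation.ReflTransGen (M.DualAdjAvoiding ∅) M.outer a) {S : Set D}
    (hS : ∀ (k : ℕ) (C : Fin (k + 1) → D), (∀ i, C i ∈ S) → ¬ M.IsClockwise C) (a : F) :
    Relation.ReflTransGen (fun a b => ∃ d, d ∉ S ∧ M.left d = a ∧ M.right d = b) M.outer a := by
  classical
  set r := fun a b => ∃ d, d ∉ S ∧ M.left d = a ∧ M.right d = b with hr
  set R : Set F := {a | Relation.ReflTransGen r M.outer a} with hR
  by_contra ha
  set B : Set D := {d | M.left d ∈ R ∧ M.right d ∉ R} with hB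
  have hBS : ∀ d ∈ B, d ∈ S := by
    intro d hd
    by_contra h
    exact hd.2 (Relation.ReflTransGen.tail hd.1 ⟨d, h, rfl, rfl⟩)
  have hne : B.Nonempty := by
    by_contra hne
    refine ha ?_
    have : ∀ b, Relation.ReflTransGen (M.DualAdjAvoiding ∅) M.outer b → b ∈ R := by
      intro b hb
      induction hb with
      | refl => exact Relation.ReflTransGen.refl
      | tail _ hs ih =>
        obtain ⟨d, -, -, rfl, rfl⟩ := hs
        by_contra h
        exact hne ⟨d, ih, h⟩
    exact this a (hconn a)
  have hnext : ∀ d ∈ B, ∃ e ∈ B, M.src e = M.tgt d := by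
    intro d hd
    by_contra! hno
    -- The jumps of the indicator of `R` around the head of `d` sum to zero. Since `rev d`
    -- contributes `-1`, some dart there contributes `+1`, that is, lies in `B`.
    have h0 := M.sum_left_sub_right (fun b => if b ∈ R then (1 : ℝ) else 0) (M.tgt d)
    have hle : ∀ e ∈ Finset.univ.filter fun e => M.src e = M.tgt d,
        (if M.left e ∈ R then (1 : ℝ) else 0) - (if M.right e ∈ R then 1 else 0) ≤ 0 := by
      intro e he
      have h1 := fun h => hno e h (Finset.mem_filter.1 he).2
      by_cases h2 : M.left e ∈ R <;> by_cases h3 : M.right e ∈ R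
      · simp [h2, h3]
      · exact absurd ⟨h2, h3⟩ h1
      · simp [h2, h3]
      · simp [h2, h3]
    have h1 := (Finset.sum_eq_zero_iff_of_nonpos hle).1 h0 (M.rev d)
      (Finset.mem_filter.2 ⟨Finset.mem_univ _, M.src_rev d⟩)
    rw [left_rev, right_rev, if_neg hd.2, if_pos hd.1] at h1
    norm_num at h1
  obtain ⟨k, C, hC, hCB⟩ := M.exists_isCycle hne hnext
  refine hS k C (fun i => hBS _ (hCB i)) ⟨hC, fun i => ?_⟩
  have hrevB : ∀ i, M.rev (C i) ∉ B := fun i h => (hCB i).2 h.1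
  -- This potential acts as a winding number: constant off `C`, but different on the two sides of `C
  -- i`. The left side is joined to the infinite face within `R`, so the right side is enclosed.
  obtain ⟨φ, hφ⟩ := hM (M.cycleCirculation C) (M.cycleCirculation_rev C)
    (M.sum_cycleCirculation hC)
  have hconst : ∀ b, Relation.ReflTransGen (M.DualAdjAvoiding (Set.range C)) M.outer b →
      φ b = φ M.outer := by
    intro b hb
    induction hb with
    | refl => rfl
    | tail _ hs ih =>
      obtain ⟨d, h1, h2, rfl, rfl⟩ := hs
      have := hφ d
      rw [M.cycleCirculation_eq_zero h1 h2] at this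
      linarith
  have hleft : ∀ b ∈ R, Relation.ReflTransGen (M.DualAdjAvoiding (Set.range C)) M.outer b := by
    intro b hb
    induction hb with
    | refl => exact Relation.ReflTransGen.refl
    | tail h0 hs ih =>
      obtain ⟨d, hdS, rfl, rfl⟩ := hs
      refine ih.tail ⟨d, ?_, ?_, rfl, rfl⟩
      · rintro ⟨j, rfl⟩
        exact hdS (hBS _ (hCB j))
      · rintro ⟨j, hj⟩
        apply (hCB j).2
        rw [hj, right_rev]
        exact h0
  intro henc
  have h1 := hconst _ henc
  have h2 := hconst _ (hleft _ (hCB i).1)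
  have h3 := M.cycleCirculation_pos (C := C) i (by rintro ⟨j, hj⟩; exact hrevB i (hj ▸ hCB j))
  rw [hφ] at h3
  linarith

end EmbeddedGraph

/-! ### Circulations and potentials in the extended graph -/

namespace PlanarNetwork

variable {V D F : Type*} (N : PlanarNetwork V D F)

theorem extSrc_inl_eq_inl {d : D} {v : V} (h : N.vcap v = ⊤) :
    N.extSrc (Sum.inl d) = Sum.inl ⟨v, h⟩ ↔ N.src d = v := by
  by_cases h' : N.vcap (N.src d) = ⊤
  · simp [extSrc, h']
  · simp only [extSrc, h', dif_neg, not_false_eq_true, reduceCtorEq, false_iff]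
    rintro rfl
    exact h' h

theorem extSrc_inl_eq_inr {d : D} {a : N.FinDart} :
    N.extSrc (Sum.inl d) = Sum.inr a ↔ d = a.1 := by
  by_cases h' : N.vcap (N.src d) = ⊤
  · simp only [extSrc, h', dif_pos, reduceCtorEq, false_iff]
    rintro rfl
    exact a.2 h'
  · simp [extSrc, h', Subtype.ext_iff]

open Classical in
theorem sum_extSrc_inl [Fintype D] (x : N.ExtDart → ℝ) {v : V} (h : N.vcap v = ⊤) :
    ∑ e with N.extSrc e = Sum.inl ⟨v, h⟩, x e = ∑ d with N.src d = v, x (Sum.inl d) := by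
  have h1 : ∀ a b, N.extSrc (Sum.inr (a, b)) ≠ Sum.inl ⟨v, h⟩ := by
    rintro a (_ | _) <;> simp [extSrc]
  rw [Finset.sum_filter, Finset.sum_filter, Fintype.sum_sum_type]
  simp [extSrc_inl_eq_inl, h1]

open Classical in
theorem sum_extSrc_inr [Fintype D] (x : N.ExtDart → ℝ) (a : N.FinDart) :
    ∑ e with N.extSrc e = Sum.inr a, x e =
      x (Sum.inl a.1) + x (Sum.inr (a, true)) + x (Sum.inr (N.finRotSymm a, false)) := by
  have h1 : ∀ b : N.FinDart, N.finRot b = a ↔ b = N.finRotSymm a := fun b =>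
    ⟨fun h => by rw [← h, finRotSymm_finRot], fun h => by rw [h, finRot_finRotSymm]⟩
  have h2 : ∀ b : N.FinDart, N.extSrc (Sum.inr (b, true)) = Sum.inr a ↔ b = a := fun b =>
    Sum.inr_injective.eq_iff
  have h3 : ∀ b : N.FinDart,
      N.extSrc (Sum.inr (b, false)) = Sum.inr a ↔ b = N.finRotSymm a := fun b =>
    Sum.inr_injective.eq_iff.trans (h1 b)
  rw [Finset.sum_filter, Fintype.sum_sum_type, Fintype.sum_prod_type]
  simp only [extSrc_inl_eq_inr, Fintype.sum_bool, h2, h3, Finset.sum_add_distrib,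
    Finset.sum_ite_eq', Finset.mem_univ, if_true]
  ring

open Classical in
/-- An antisymmetric function that is conserved at all vertices of `C_v` is conserved at `v` in the
original graph. -/
theorem sum_src_eq_zero [Fintype D] {x : N.ExtDart → ℝ} (hx : ∀ e, x (N.extRev e) = -x e) {v : V}
    (hinf : ∀ h : N.vcap v = ⊤, ∑ e with N.extSrc e = Sum.inl ⟨v, h⟩, x e = 0)
    (hfin : ∀ a : N.FinDart, N.src a.1 = v → ∑ e with N.extSrc e = Sum.inr a, x e = 0) :
    ∑ d with N.src d = v, x (Sum.inl d) = 0 := by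
  by_cases h : N.vcap v = ⊤
  · rw [← N.sum_extSrc_inl x h, hinf h]
  -- The circulation along `C_v`: conservation at each of its vertices makes the sum over the darts
  -- at `v` telescope cyclically.
  · let y : D → ℝ := fun d => if h : N.vcap (N.src d) ≠ ⊤ then x (Sum.inr (⟨d, h⟩, true)) else 0
    have h1 : ∀ d ∈ Finset.univ.filter fun d => N.src d = v,
        x (Sum.inl d) = y (N.rot.symm d) - y d := by
      intro d hd
      obtain rfl := (Finset.mem_filter.1 hd).2
      have h2 := hfin ⟨d, h⟩ rfl
      have h3 : x (Sum.inr (N.finRotSymm ⟨d, h⟩, false)) =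
        -x (Sum.inr (N.finRotSymm ⟨d, h⟩, true)) := hx (Sum.inr (_, true))
      rw [sum_extSrc_inr, h3] at h2
      have h4 : y d = x (Sum.inr (⟨d, h⟩, true)) := dif_pos h
      have h5 : y (N.rot.symm d) = x (Sum.inr (N.finRotSymm ⟨d, h⟩, true)) :=
        dif_pos (N.finRotSymm ⟨d, h⟩).2
      rw [h4, h5]
      change x (Sum.inl d) + _ + _ = 0 at h2
      linarith
    rw [Finset.sum_congr rfl h1, Finset.sum_sub_distrib, sub_eq_zero, Finset.sum_filter,
      Finset.sum_filter, ← Equiv.sum_comp N.rot.symm fun d => if N.src d = v then y d else 0]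
    simp only [src_rot_symm]

/-- The extended graph is planar. -/
theorem hasPotentials_extGraph [Fintype D] (hN : N.HasPotentials) : N.extGraph.HasPotentials := by
  classical
  intro x hx hv
  have hx' : ∀ e, x (N.extRev e) = -x e := hx
  have hv' : ∀ v, ∑ e with N.extSrc e = v, x e = 0 := fun v => by
    convert hv v
    rfl
  obtain ⟨φ, hφ⟩ := hN (fun d => x (Sum.inl d)) (fun d => hx (Sum.inl d))
    (fun v => N.sum_src_eq_zero hx' (fun h => hv' _) (fun a _ => hv' _))
  -- The value that the dart `(a, true)` forces on the disc inside `C_v`; conservation makes it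
  -- independent of `a`.
  let p : N.FinDart → ℝ := fun a => x (Sum.inr (a, true)) + φ (N.left a.1)
  have hrot : ∀ a, p (N.finRot a) = p a := by
    intro a
    have h1 := hv' (Sum.inr (N.finRot a))
    have h2 : x (Sum.inr (a, false)) = -x (Sum.inr (a, true)) := hx (Sum.inr (a, true))
    rw [sum_extSrc_inr, finRotSymm_finRot, h2, hφ] at h1
    have h3 : N.right (N.finRot a).1 = N.left a.1 := N.right_rot a.1
    rw [h3] at h1
    simp only [p]
    linarith
  have hsrc : ∀ a b : N.FinDart, N.src a.1 = N.src b.1 → p a = p b := by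
    intro a b hab
    have := N.forall_of_src_eq (p := fun d => ∀ h : N.vcap (N.src d) ≠ ⊤, p ⟨d, h⟩ = p a)
      (v := N.src a.1) (d := a.1) (e := b.1) (fun d hd hp h => by
        have h' : N.vcap (N.src d) ≠ ⊤ := by rw [hd]; exact a.2
        exact (hrot ⟨d, h'⟩).trans (hp h')) rfl hab.symm (fun _ => rfl)
    exact (this b.2).symm
  have hdisc : ∀ w : {v : V // N.vcap v ≠ ⊤ ∧ ∃ d, N.src d = v}, ∃ a : N.FinDart,
      N.src a.1 = w.1 := by
    rintro ⟨_, h, d, rfl⟩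
    exact ⟨⟨d, h⟩, rfl⟩
  choose g hg using hdisc
  have htrue : ∀ a, x (Sum.inr (a, true)) =
      p (g ⟨N.src a.1, a.2, a.1, rfl⟩) - φ (N.left a.1) := by
    intro a
    rw [hsrc _ a (hg _)]
    simp [p]
  refine ⟨Sum.elim φ fun w => p (g w), ?_⟩
  rintro (d | ⟨a, _ | _⟩)
  · exact hφ d
  · have h2 : x (Sum.inr (a, false)) = -x (Sum.inr (a, true)) := hx (Sum.inr (a, true))
    rw [h2, htrue, neg_sub]
    rfl
  · exact htrue a

theorem extGraph_dual_connected (a : N.ExtFace) :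
    Relation.ReflTransGen (N.extGraph.DualAdjAvoiding ∅) N.extGraph.outer a := by
  have hinl : ∀ b : F, Relation.ReflTransGen (N.extGraph.DualAdjAvoiding ∅)
      N.extGraph.outer (Sum.inl b) := fun b =>
    (N.isPlanar.1 N.outer b).lift Sum.inl (by
      rintro _ _ ⟨d, -, -, rfl, rfl⟩
      exact ⟨Sum.inl d, by simp, by simp, rfl, rfl⟩)
  rcases a with b | ⟨_, h, d, rfl⟩
  · exact hinl b
  · exact (hinl (N.left d)).tail ⟨Sum.inr (⟨d, h⟩, false), by simp, by simp, rfl, rfl⟩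

end PlanarNetwork

/-! ### Strongly connected components and counterclockwise regions -/

namespace EmbeddedGraph

variable {V D F : Type*} (M : EmbeddedGraph V D F)

/-- Some dart of `S` goes from `u` to `v`. -/
def AdjIn (S : Set D) (u v : V) : Prop := ∃ d ∈ S, M.src d = u ∧ M.tgt d = v

open Classical in
theorem exists_unit_flow [Fintype D] {S : Set D} {u w : V}
    (h : Relation.ReflTransGen (M.AdjIn S) u w) :
    ∃ k : D → ℝ, (∀ d, 0 ≤ k d) ∧ (∀ d ∉ S, k d = 0) ∧
      ∀ v, ∑ d with M.src d = v, (k d - k (M.rev d)) =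
        (if u = v then 1 else 0) - (if w = v then 1 else 0) := by
  induction h with
  | refl => exact ⟨0, by simp, by simp, by simp⟩
  | tail _ hs ih =>
    obtain ⟨k, h1, h2, h3⟩ := ih
    obtain ⟨d, hd, rfl, rfl⟩ := hs
    refine ⟨fun e => k e + if e = d then 1 else 0, fun e => ?_, fun e he => ?_, fun v => ?_⟩
    · have := h1 e
      positivity
    · simp only [h2 e he, if_neg (show e ≠ d by rintro rfl; exact he hd), add_zero]
    · simp only [add_sub_add_comm, Finset.sum_add_distrib, h3, M.sum_unit d v]
      ring

open Classical in
/-- If every dart of `S` can be closed up within `S`, then some circulation is positive exactly on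
`S`. -/
theorem exists_pos_circulation [Fintype D] {S : Set D}
    (hS : ∀ d ∈ S, Relation.ReflTransGen (M.AdjIn S) (M.tgt d) (M.src d)) :
    ∃ k : D → ℝ, (∀ d ∈ S, 0 < k d) ∧ (∀ d ∉ S, k d = 0) ∧
      ∀ v, ∑ d with M.src d = v, (k d - k (M.rev d)) = 0 := by
  have h : ∀ d, ∃ k : D → ℝ, (∀ e, 0 ≤ k e) ∧ (∀ e ∉ S, k e = 0) ∧
      (∀ v, ∑ e with M.src e = v, (k e - k (M.rev e)) = 0) ∧ (d ∈ S → 0 < k d) := by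
    intro d
    by_cases hd : d ∈ S
    · obtain ⟨k, h1, h2, h3⟩ := M.exists_unit_flow (hS d hd)
      refine ⟨fun e => k e + if e = d then 1 else 0, fun e => ?_, fun e he => ?_, fun v => ?_,
        fun _ => ?_⟩
      · have := h1 e
        positivity
      · simp only [h2 e he, if_neg (show e ≠ d by rintro rfl; exact he hd), add_zero]
      · simp only [add_sub_add_comm, Finset.sum_add_distrib, h3, M.sum_unit d v]
        ring
      · have := h1 d
        simp only [if_true]
        positivity
    · exact ⟨0, by simp, by simp, by simp, fun h => absurd h hd⟩
  choose k h1 h2 h3 h4 using h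
  refine ⟨fun e => ∑ d, k d e, fun e he => ?_, fun e he => ?_, fun v => ?_⟩
  · exact Finset.sum_pos' (fun d _ => h1 d e) ⟨e, Finset.mem_univ _, h4 e he⟩
  · exact Finset.sum_eq_zero fun d _ => h2 d e he
  · simp only [← Finset.sum_sub_distrib]
    rw [Finset.sum_comm]
    exact Finset.sum_eq_zero fun d _ => h3 d v

-- The potential belongs to the net flow of a circulation positive exactly on `S`. Where both darts
-- of an edge lie in `S` the sign of the net flow is unknown, so nothing is claimed there.
variable {M} in
theorem HasPotentials.exists_strict_potential [Fintype D] (hM : M.HasPotentials) {S : Set D}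
    (hS : ∀ d ∈ S, Relation.ReflTransGen (M.AdjIn S) (M.tgt d) (M.src d)) :
    ∃ φ : F → ℝ, (∀ d, d ∉ S → M.rev d ∉ S → φ (M.left d) = φ (M.right d)) ∧
      ∀ d ∈ S, M.rev d ∉ S → φ (M.right d) < φ (M.left d) := by
  obtain ⟨k, h1, h2, h3⟩ := M.exists_pos_circulation hS
  obtain ⟨φ, hφ⟩ := hM (fun d => k d - k (M.rev d)) (fun d => by simp [M.rev_rev]) h3
  refine ⟨φ, fun d hd hd' => ?_, fun d hd hd' => ?_⟩
  · have := hφ d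
    rw [h2 d hd, h2 _ hd'] at this
    linarith
  · have := hφ d
    rw [h2 _ hd'] at this
    linarith [h1 d hd]

/-- The darts of `H` that run within the set `Q` of vertices. -/
def dartsIn (H : Set D) (Q : Set V) : Set D := {d | d ∈ H ∧ M.src d ∈ Q ∧ M.tgt d ∈ Q}

/-- A set of faces that does not contain the infinite face, such that the edges of the strongly
connected subgraph with vertex set `Q` that bound it have it on their left. -/
structure IsCcwRegion (H : Set D) (Q : Set V) (Ψ : Set F) : Prop where
  outer_notMem : M.outer ∉ Ψ
  nonempty : Ψ.Nonempty
  right_mem : ∀ d, d ∉ M.dartsIn H Q → M.rev d ∉ M.dartsIn H Q → M.left d ∈ Ψ → M.right d ∈ Ψ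
  right_notMem : ∀ d ∈ M.dartsIn H Q, M.rev d ∉ M.dartsIn H Q → M.right d ∉ Ψ
  mem_of_reach : ∀ u v w, u ∈ Q → Relation.ReflTransGen (M.AdjIn H) u v →
    Relation.ReflTransGen (M.AdjIn H) v w → w ∈ Q → v ∈ Q

variable {M} in
theorem IsCycle.reflTransGen {k : ℕ} {C : Fin (k + 1) → D} (hC : M.IsCycle C) {H : Set D}
    (hH : ∀ i, C i ∈ H) (i : Fin (k + 1)) :
    Relation.ReflTransGen (M.AdjIn H) (M.src (C 0)) (M.src (C i)) ∧
      Relation.ReflTransGen (M.AdjIn H) (M.src (C i)) (M.src (C 0)) := by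
  have h : ∀ i, M.AdjIn H (M.src (C i)) (M.src (C (i + 1))) := fun i => ⟨_, hH i, rfl, hC.1 i⟩
  constructor
  · induction i using Fin.induction with
    | zero => exact Relation.ReflTransGen.refl
    | succ i ih => exact ih.tail (by simpa using h i.castSucc)
  · induction i using Fin.reverseInduction with
    -- Here `Fin.last k + 1 = 0`, so the cycle closes.
    | last => exact Relation.ReflTransGen.single (by simpa using h (Fin.last k))
    | cast i ih => exact ih.head (by simpa using h i.castSucc)

variable {M} in
/-- Every counterclockwise cycle in `H` gives rise to a counterclockwise region of the strongly
connected component of `H` that contains it. -/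
theorem HasPotentials.exists_isCcwRegion [Fintype D] [Finite F] (hM : M.HasPotentials) {H : Set D}
    {k : ℕ} {C : Fin (k + 1) → D} (hC : M.IsCounterclockwise C) (hH : ∀ i, C i ∈ H) :
    ∃ Q Ψ, M.IsCcwRegion H Q Ψ := by
  set Q : Set V := {w | Relation.ReflTransGen (M.AdjIn H) (M.src (C 0)) w ∧
    Relation.ReflTransGen (M.AdjIn H) w (M.src (C 0))} with hQ
  have hreach : ∀ u v w, u ∈ Q → Relation.ReflTransGen (M.AdjIn H) u v →
      Relation.ReflTransGen (M.AdjIn H) v w → w ∈ Q → v ∈ Q := fun u v w hu huv hvw hw =>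
    ⟨hu.1.trans huv, hvw.trans hw.2⟩
  have hCQ : ∀ i, M.src (C i) ∈ Q := fun i =>
    hC.1.reflTransGen hH i
  have hCS : ∀ i, C i ∈ M.dartsIn H Q := fun i =>
    ⟨hH i, hCQ i, by rw [hC.1.1]; exact hCQ (i + 1)⟩
  have hpath : ∀ u w, u ∈ Q → Relation.ReflTransGen (M.AdjIn H) u w → w ∈ Q →
      Relation.ReflTransGen (M.AdjIn (M.dartsIn H Q)) u w := by
    intro u w hu huw hw
    induction huw using Relation.ReflTransGen.head_induction_on with
    | refl => exact Relation.ReflTransGen.refl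
    | head hs ht ih =>
      have hv := hreach _ _ _ hu (Relation.ReflTransGen.single hs) ht hw
      obtain ⟨d, hd, rfl, rfl⟩ := hs
      exact (ih hv).head ⟨d, ⟨hd, hu, hv⟩, rfl, rfl⟩
  obtain ⟨φ, hφ1, hφ2⟩ := hM.exists_strict_potential (S := M.dartsIn H Q) (fun d hd =>
    hpath _ _ hd.2.2 (hd.2.2.2.trans hd.2.1.1) hd.2.1)
  set I : Set F := {a | M.Encloses C a} with hI
  have hIstep : ∀ d, d ∉ Set.range C → M.rev d ∉ Set.range C → M.left d ∈ I → M.right d ∈ I := by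
    intro d h1 h2 h3 h4
    exact h3 (h4.tail ⟨M.rev d, h2, by rwa [M.rev_rev], rfl, M.right_rev d⟩)
  have hrange : ∀ d, d ∉ M.dartsIn H Q → d ∉ Set.range C := by
    rintro _ hd ⟨i, rfl⟩
    exact hd (hCS i)
  -- A one-way dart of the component with a maximal face on its right would have an enclosed face of
  -- larger potential on its left.
  obtain ⟨b, hbI, hb⟩ := Set.exists_max_image I φ (Set.toFinite I) ⟨_, hC.2 0⟩
  refine ⟨Q, {a | a ∈ I ∧ φ a = φ b}, ?_, ⟨b, hbI, rfl⟩, ?_, ?_, hreach⟩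
  · exact fun h => h.1 Relation.ReflTransGen.refl
  · rintro d h1 h2 ⟨h3, h4⟩
    exact ⟨hIstep d (hrange _ h1) (hrange _ h2) h3, (hφ1 d h1 h2).symm.trans h4⟩
  · rintro d h1 h2 ⟨h3, h4⟩
    have hl : M.left d ∈ I := by
      by_cases h5 : d ∈ Set.range C
      · obtain ⟨i, rfl⟩ := h5
        exact hC.2 i
      · have := hIstep (M.rev d) (hrange _ h2) (by rwa [M.rev_rev]) h3
        rwa [right_rev] at this
    linarith [hb _ hl, hφ2 d h1 h2]

variable {M} in
theorem IsCcwRegion.left_mem {H : Set D} {Q : Set V} {Ψ : Set F} (h : M.IsCcwRegion H Q Ψ) {d : D}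
    (h1 : d ∉ M.dartsIn H Q) (h2 : M.rev d ∉ M.dartsIn H Q) (h3 : M.right d ∈ Ψ) :
    M.left d ∈ Ψ := by
  have := h.right_mem (M.rev d) h2 (by rwa [M.rev_rev]) h3
  rwa [right_rev] at this

variable {M} in
/-- Around a vertex outside of `Q`, all faces belong to the region if one does. -/
theorem IsCcwRegion.left_mem_of_src_notMem [Finite D] {H : Set D} {Q : Set V} {Ψ : Set F}
    (h : M.IsCcwRegion H Q Ψ) {d e : D} (hd : M.src d ∉ Q) (hde : M.src e = M.src d)
    (hl : M.left d ∈ Ψ) : M.left e ∈ Ψ := by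
  refine M.forall_of_src_eq (p := fun d => M.left d ∈ Ψ) (fun x hx hp => ?_) rfl hde hl
  refine h.left_mem (fun h1 => hd ?_) (fun h1 => hd ?_) (by rwa [right_rot])
  · rw [← hx, ← M.src_rot']
    exact h1.2.1
  · rw [← hx, ← M.src_rot', ← M.tgt_rev]
    exact h1.2.2

end EmbeddedGraph

/-! ### Flow does not leave the component inside the region -/

namespace PlanarNetwork

variable {V D F : Type*} (N : PlanarNetwork V D F)

open Classical in
/-- No flow leaves the component `Q` through a counterclockwise region. -/
theorem mem_of_isCcwRegion [Fintype V] [Fintype D] {g : D → ℝ} (hg0 : ∀ d, 0 ≤ g d)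
    (harcs : ∀ d, 0 < g d → d ∈ N.arcs)
    (hg : ∀ v, v ≠ N.s → v ≠ N.t → ∑ d with N.src d = v, (g d - g (N.rev d)) = 0)
    {Q : Set V} {Ψ : Set F} (h : N.IsCcwRegion {d | 0 < g d} Q Ψ) {x : D} (hx : 0 < g x)
    (hxQ : N.src x ∈ Q) (hxΨ : N.left x ∈ Ψ) : N.tgt x ∈ Q := by
  by_contra htQ
  set H : Set D := {d | 0 < g d} with hH
  -- Flow entering `U` is trapped. `U` misses `Q`, else `tgt x` would be in `Q`; so all faces around
  -- it lie in `Ψ`, and `t`, being on the infinite face, is not in it. Nor is `s`, which has no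
  -- incoming arc. Thus conservation holds throughout `U`, yet `x` brings flow in and none gets out.
  set U : Set V := {w | Relation.ReflTransGen (N.AdjIn H) (N.tgt x) w} with hU
  have hUQ : ∀ w ∈ U, w ∉ Q := fun w hw hwQ =>
    htQ (h.mem_of_reach _ _ _ hxQ (Relation.ReflTransGen.single ⟨x, hx, rfl, rfl⟩) hw hwQ)
  have hlast : ∀ w ∈ U, ∃ y, 0 < g y ∧ N.tgt y = w := by
    intro w hw
    rcases Relation.ReflTransGen.cases_tail hw with rfl | ⟨_, -, y, hy, -, rfl⟩
    · exact ⟨x, hx, rfl⟩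
    · exact ⟨y, hy, rfl⟩
  have hcross : ∀ y, N.tgt y ∉ Q → N.left y ∈ Ψ → ∀ e, N.src e = N.tgt y → N.left e ∈ Ψ := by
    intro y hy hl e he
    refine h.left_mem_of_src_notMem (d := N.rev y) hy he ?_
    exact h.right_mem y (fun h1 => hy h1.2.2) (fun h1 => hy h1.2.1) hl
  have hUΨ : ∀ w ∈ U, ∀ e, N.src e = w → N.left e ∈ Ψ := by
    intro w hw
    induction hw with
    | refl => exact hcross x htQ hxΨ
    | tail hw hs ih =>
      obtain ⟨y, hy, rfl, rfl⟩ := hs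
      exact hcross y (hUQ _ (Relation.ReflTransGen.tail hw ⟨y, hy, rfl, rfl⟩)) (ih y rfl)
  have hsU : ∀ w ∈ U, w ≠ N.s := by
    rintro w hw rfl
    obtain ⟨y, hy, hyw⟩ := hlast _ hw
    exact N.tgt_ne_s y (harcs y hy) hyw
  have htU : ∀ w ∈ U, w ≠ N.t := by
    rintro w hw rfl
    obtain ⟨y, hy, hyw⟩ := hlast _ hw
    obtain ⟨d, hd, hdo⟩ := N.t_outer ⟨N.rev y, hyw⟩
    exact h.outer_notMem (hdo ▸ hUΨ _ hw d hd)
  have hsum : ∑ d with N.src d ∈ U, (g d - g (N.rev d)) = 0 := by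
    rw [← Finset.sum_fiberwise_of_maps_to (g := N.src) (t := Finset.univ.filter (· ∈ U))
      (fun d hd => by simpa using hd)]
    refine Finset.sum_eq_zero fun v hv => ?_
    have hv' : v ∈ U := (Finset.mem_filter.1 hv).2
    rw [← hg v (hsU v hv') (htU v hv'), Finset.filter_filter]
    refine Finset.sum_congr (Finset.filter_congr fun d _ => ?_) fun _ _ => rfl
    exact ⟨fun h => h.2, fun h => ⟨by rw [h]; exact hv', h⟩⟩
  have hrev : ∑ d with N.src d ∈ U, g (N.rev d) = ∑ d with N.tgt d ∈ U, g d := by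
    rw [Finset.sum_filter, Finset.sum_filter,
      ← Equiv.sum_comp (Function.Involutive.toPerm N.rev N.rev_rev)]
    refine Finset.sum_congr rfl fun d _ => ?_
    change (if N.tgt d ∈ U then g (N.rev (N.rev d)) else 0) = _
    rw [N.rev_rev]
  rw [Finset.sum_sub_distrib, hrev, sub_eq_zero] at hsum
  have hle : ∑ d with N.src d ∈ U, g d < ∑ d with N.tgt d ∈ U, g d := by
    rw [Finset.sum_filter, Finset.sum_filter]
    refine Finset.sum_lt_sum (fun d _ => ?_) ⟨x, Finset.mem_univ _, ?_⟩
    · by_cases h1 : N.src d ∈ U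
      · by_cases h2 : N.tgt d ∈ U
        · simp [h1, h2]
        · have h3 : ¬ 0 < g d := fun h3 =>
            h2 (Relation.ReflTransGen.tail h1 ⟨d, h3, rfl, rfl⟩)
          simp only [h1, h2, if_true, if_false]
          exact not_lt.1 h3
      · simp only [h1, if_false]
        split_ifs
        exacts [hg0 d, le_rfl]
    · have h1 : N.src x ∉ U := fun h1 => hUQ _ h1 hxQ
      have h2 : N.tgt x ∈ U := Relation.ReflTransGen.refl
      simpa [h1, h2] using hx
  exact hle.ne hsum

end PlanarNetwork

/-! ### Conservation and saturation around `C_v` -/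

namespace EmbeddedGraph

variable {V D F : Type*} (M : EmbeddedGraph V D F)

open Classical in
theorem inflow_eq [Fintype D] (f : D → ℝ) (v : V) :
    M.inflow f v = ∑ d with M.src d = v, f (M.rev d) := by
  rw [inflow, Finset.sum_filter, Finset.sum_filter,
    ← Equiv.sum_comp (Function.Involutive.toPerm M.rev M.rev_rev)]
  refine Finset.sum_congr rfl fun d _ => ?_
  exact if_congr (by rw [← M.tgt_rev]; rfl) rfl rfl

variable {M} in
open Classical in
theorem IsFlow.sum_sub_eq_zero [Fintype D] {c : D → ℝ≥0∞} {s t : V} {f : D → ℝ}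
    (hf : M.IsFlow c s t f) {v : V} (hs : v ≠ s) (ht : v ≠ t) :
    ∑ d with M.src d = v, (f d - f (M.rev d)) = 0 := by
  rw [Finset.sum_sub_distrib, ← inflow_eq, hf.2 v hs ht, sub_eq_zero, outflow]

variable {M} in
theorem IsFlow.le_toReal [Fintype D] {c : D → ℝ≥0∞} {s t : V} {f : D → ℝ}
    (hf : M.IsFlow c s t f) {d : D} (hc : c d ≠ ⊤) : f d ≤ (c d).toReal :=
  (ENNReal.ofReal_le_iff_le_toReal hc).1 (hf.1 d).2

theorem resCap_eq {c : D → ℝ≥0∞} {f : D → ℝ} {d : D} (hc : c d ≠ ⊤) :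
    M.resCap c f d = (((c d).toReal - f d + f (M.rev d) : ℝ) : EReal) := by
  rw [resCap, ← EReal.coe_ennreal_toReal hc]
  push_cast
  rfl

end EmbeddedGraph

namespace PlanarNetwork

variable {V D F : Type*} (N : PlanarNetwork V D F)

theorem cappedCap_ne_top (f : N.ExtDart → ℝ) (e : N.ExtDart) : N.cappedCap f e ≠ ⊤ := by
  rcases e with d | ⟨a, b⟩
  · simp only [cappedCap]
    split_ifs <;> simp
  · exact ENNReal.div_ne_top a.2 (by simp)

/-- The conservation law of the extended graph, at a vertex of some `C_v`. -/
theorem net_rot_eq [Fintype D] {c : N.ExtDart → ℝ≥0∞} {f : N.ExtDart → ℝ}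
    (hf : N.extGraph.IsFlow c N.extS N.extT f) (a : N.FinDart) :
    f (Sum.inr (N.finRot a, true)) - f (Sum.inr (N.finRot a, false)) =
      f (Sum.inr (a, true)) - f (Sum.inr (a, false)) +
        f (Sum.inl (N.rev (N.rot a.1))) - f (Sum.inl (N.rot a.1)) := by
  classical
  have h := hf.sum_sub_eq_zero (v := Sum.inr (N.finRot a)) Sum.inr_ne_inl Sum.inr_ne_inl
  have h1 := N.sum_extSrc_inr (fun e => f e - f (N.extGraph.rev e)) (N.finRot a)
  have h2 : ∑ e with N.extSrc e = Sum.inr (N.finRot a), (f e - f (N.extGraph.rev e)) = 0 := by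
    convert h
    rfl
  rw [finRotSymm_finRot] at h1
  have h3 := h1.symm.trans (by convert h2)
  change (f (Sum.inl (N.rot a.1)) - f (Sum.inl (N.rev (N.rot a.1)))) +
    (f (Sum.inr (N.finRot a, true)) - f (Sum.inr (N.finRot a, false))) +
    (f (Sum.inr (a, false)) - f (Sum.inr (a, true))) = 0 at h3
  linarith

open Classical in
/-- The restriction of a flow to the original graph satisfies the conservation law. -/
theorem sum_restrict_sub_eq_zero [Fintype D] {c : N.ExtDart → ℝ≥0∞} {f : N.ExtDart → ℝ}
    (hf : N.extGraph.IsFlow c N.extS N.extT f) {v : V} (hs : v ≠ N.s) (ht : v ≠ N.t) :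
    ∑ d with N.src d = v, (N.restrict f d - N.restrict f (N.rev d)) = 0 := by
  have key : ∀ w : N.ExtVertex, w ≠ N.extS → w ≠ N.extT →
      ∑ e with N.extSrc e = w, (f e - f (N.extRev e)) = 0 := by
    intro w h1 h2
    convert hf.sum_sub_eq_zero h1 h2
    · rfl
    · rfl
  refine N.sum_src_eq_zero (x := fun e => f e - f (N.extRev e)) (fun e => ?_) (fun h => ?_)
    (fun a _ => ?_)
  · rw [show N.extRev (N.extRev e) = e from N.extGraph.rev_rev e, neg_sub]
  · refine key _ (fun h1 => hs ?_) (fun h1 => ht ?_)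
    · exact congrArg Subtype.val (Sum.inl_injective h1)
    · exact congrArg Subtype.val (Sum.inl_injective h1)
  · exact key _ Sum.inr_ne_inl Sum.inr_ne_inl

/-- No saturated counterclockwise dart of some `C_v` leads into a counterclockwise region of the
flow unless all faces around `v` belong to the region. -/
theorem left_mem_of_saturated [Fintype V] [Fintype D] {f f' : N.ExtDart → ℝ}
    (hf' : N.extGraph.IsFlow (N.cappedCap f) N.extS N.extT f')
    (harcs : ∀ d, 0 < N.restrict f' d → d ∈ N.arcs) {Q : Set V} {Ψ : Set F}
    (h : N.IsCcwRegion {d | 0 < N.restrict f' d} Q Ψ) {a : N.FinDart}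
    (hsat : f' (Sum.inr (a, true)) = (N.vcap (N.src a.1) / 2).toReal)
    (hsat' : f' (Sum.inr (a, false)) = 0) (ha : N.left a.1 ∈ Ψ) {d : D}
    (hd : N.src d = N.src a.1) : N.left d ∈ Ψ := by
  set H : Set D := {d | 0 < N.restrict f' d} with hH
  by_cases hvQ : N.src a.1 ∈ Q
  swap
  · exact h.left_mem_of_src_notMem hvQ hd ha
  set c : ℝ := (N.vcap (N.src a.1) / 2).toReal with hc
  have hf0 : ∀ e, 0 ≤ f' e := fun e => (hf'.1 e).1
  have hle : ∀ b : N.FinDart, N.src b.1 = N.src a.1 → f' (Sum.inr (b, true)) ≤ c := by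
    intro b hb
    have := hf'.le_toReal (N.cappedCap_ne_top f (Sum.inr (b, true)))
    simpa only [cappedCap, hb] using this
  have hstep : ∀ b : N.FinDart, N.src b.1 = N.src a.1 →
      c ≤ f' (Sum.inr (b, true)) - f' (Sum.inr (b, false)) → N.left b.1 ∈ Ψ →
      c ≤ f' (Sum.inr (N.finRot b, true)) - f' (Sum.inr (N.finRot b, false)) ∧
        N.left (N.rot b.1) ∈ Ψ := by
    intro b hb hcb hlb
    have hnet := N.net_rot_eq hf' b
    have hub := hle (N.finRot b) ((N.src_rot b.1).trans hb)
    have hfb := hf0 (Sum.inr (N.finRot b, false))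
    have hr : N.right (N.rot b.1) ∈ Ψ := by rwa [N.right_rot]
    -- Incoming flow would push the net flow on the next dart of `C_v` above `c`: the same edge
    -- carries no outgoing flow, as it is not shared by antiparallel arcs.
    by_cases hin : N.rev (N.rot b.1) ∈ N.dartsIn H Q
    · exfalso
      have h1 : 0 < f' (Sum.inl (N.rev (N.rot b.1))) := hin.1
      have h2 : ¬ 0 < f' (Sum.inl (N.rot b.1)) := by
        intro h2
        refine N.rev_notMem_of_vcap _ (harcs _ h2) ?_ (harcs _ h1)
        rw [N.src_rot]
        exact b.2
      linarith
    · have hout : N.rot b.1 ∉ N.dartsIn H Q := fun hout => h.right_notMem _ hout hin hr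
      have hl := h.left_mem hout hin hr
      refine ⟨?_, hl⟩
      -- Outgoing flow would have to stay in `Q`, making `rot b` a dart of the component with `Ψ` on
      -- its right. Without it the net flow cannot drop.
      by_cases hz : 0 < f' (Sum.inl (N.rot b.1))
      swap
      · have := hf0 (Sum.inl (N.rev (N.rot b.1)))
        linarith
      refine absurd ⟨hz, ?_, N.mem_of_isCcwRegion (fun d => hf0 _) harcs
        (fun v => N.sum_restrict_sub_eq_zero hf') h hz ?_ hl⟩ hout <;> rwa [N.src_rot, hb]
  have := N.forall_of_src_eq (v := N.src a.1) (d := a.1) (e := d)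
    (p := fun d => ∀ h : N.vcap (N.src d) ≠ ⊤,
      c ≤ f' (Sum.inr (⟨d, h⟩, true)) - f' (Sum.inr (⟨d, h⟩, false)) ∧ N.left d ∈ Ψ)
    (fun x hx hp _ => by
      have h' : N.vcap (N.src x) ≠ ⊤ := by rw [hx]; exact a.2
      exact hstep ⟨x, h'⟩ hx (hp h').1 (hp h').2) rfl hd
    (fun _ => ⟨(by rw [hsat, hsat', sub_zero] :
      c ≤ f' (Sum.inr (a, true)) - f' (Sum.inr (a, false))), ha⟩)
  exact (this (by rw [hd]; exact a.2)).2

end PlanarNetwork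

/-! ### The contradiction -/

theorem mainTheorem4 {V D F : Type*} [Fintype V] [Fintype D] [Fintype F]
    (N : PlanarNetwork V D F) (f f' : N.ExtDart → ℝ)
    (hf : N.extGraph.IsFlow N.extCap N.extS N.extT f)
    (hf' : N.extGraph.IsFlow (N.cappedCap f) N.extS N.extT f')
    (hvalue : N.extGraph.inflow f' N.extT = N.extGraph.inflow f N.extT)
    (hres : ∀ (k : ℕ) (C : Fin (k + 1) → N.ExtDart),
      (∀ i, 0 < N.extGraph.resCap (N.cappedCap f) f' (C i)) → ¬ N.extGraph.IsClockwise C) :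
    ∀ (k : ℕ) (C : Fin (k + 1) → D),
      N.IsFlowCycle (N.restrict f') C → ¬ N.IsCounterclockwise C := by
  classical
  intro k C hflow hccw
  have hf0 : ∀ e, 0 ≤ f' e := fun e => (hf'.1 e).1
  have hle : ∀ e, f' e ≤ (N.cappedCap f e).toReal := fun e =>
    hf'.le_toReal (N.cappedCap_ne_top f e)
  have harcs : ∀ d, 0 < N.restrict f' d → d ∈ N.arcs := by
    intro d hd
    by_contra h
    have := hle (Sum.inl d)
    simp only [PlanarNetwork.cappedCap, h, if_false, ENNReal.toReal_zero] at this
    exact this.not_gt hd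
  have hpot := EmbeddedGraph.IsPlanar.hasPotentials N.toEmbeddedGraph N.isPlanar
  obtain ⟨Q, Ψ, h⟩ := hpot.exists_isCcwRegion hccw (H := {d | 0 < N.restrict f' d})
    fun i => (hflow.2 i).2
  obtain ⟨b, hb⟩ := h.nonempty
  set S : Set N.ExtDart := {e | 0 < N.extGraph.resCap (N.cappedCap f) f' e}
  -- The residual capacity is the sum of the nonnegative terms `c' e - f' e` and `f' (rev e)`, so
  -- both vanish.
  have hsat : ∀ e ∉ S, f' e = (N.cappedCap f e).toReal ∧ f' (N.extRev e) = 0 := by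
    intro e he
    have h1 : N.extGraph.resCap (N.cappedCap f) f' e ≤ 0 := not_lt.1 he
    rw [N.extGraph.resCap_eq (N.cappedCap_ne_top f e), ← EReal.coe_zero, EReal.coe_le_coe_iff] at h1
    have h2 : N.extGraph.rev e = N.extRev e := rfl
    rw [h2] at h1
    have h3 := hle e
    have h4 := hf0 (N.extRev e)
    constructor <;> linarith
  -- A disc counts as inside only if all faces around its vertex do. Leaving a disc into `Ψ` is then
  -- the only crossing that needs saturation of `C_v`.
  let Ψ' : Set N.ExtFace := {a | Sum.elim (· ∈ Ψ) (fun v => ∀ d, N.src d = v.1 → N.left d ∈ Ψ) a}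
  have hnot : ∀ a, Relation.ReflTransGen
      (fun a b => ∃ e, e ∉ S ∧ N.extGraph.left e = a ∧ N.extGraph.right e = b)
      N.extGraph.outer a → a ∉ Ψ' := by
    intro a ha
    induction ha with
    | refl => exact h.outer_notMem
    | tail _ hs ih =>
      obtain ⟨e, he, rfl, rfl⟩ := hs
      obtain ⟨h1, h2⟩ := hsat e he
      rcases e with d | ⟨a, _ | _⟩
      · intro hr
        have hr' : N.right d ∈ Ψ := hr
        have hrev : N.rev d ∉ N.dartsIn {d | 0 < N.restrict f' d} Q := fun h3 => h3.1.ne' h2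
        by_cases hd : d ∈ N.dartsIn {d | 0 < N.restrict f' d} Q
        · exact h.right_notMem d hd hrev hr'
        · exact ih (h.left_mem hd hrev hr')
      · exact fun hr => ih (hr a.1 rfl)
      · exact fun hr => ih fun d hd => N.left_mem_of_saturated hf' harcs h h1 h2 hr hd
  exact hnot (Sum.inl b) (N.extGraph.reachable_of_no_isClockwise
    (N.hasPotentials_extGraph hpot) N.extGraph_dual_connected hres _) hb
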